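/- Let $t\ge 1$ be an integer and $N=(t+1)^2$. Let $S^2\subset\mathbb{R}^3$ be the unit sphere with surface measure $\omega$, $|S^2|=4\pi$, and geodesic distance $\mathrm{dist}(x,y)=\arccos(x\cdot y)$; a spherical polynomial of degree $\le t$ is the restriction to $S^2$ of a real polynomial in three variables of degree at most $t$. A set of $N$ points $X_N=\{x_1,\dots,x_N\}\subset S^2$ is a *spherical $t$-design* if $\frac1N\sum_{i}p(x_i)=\frac1{|S^2|}\int_{S^2}p\,d\omega$ for all spherical polynomials $p$ of degree $\le t$. For $0\le\epsilon<1$ it is a *spherical $t_\epsilon$-design* if there are weights $w_i$ with $\frac{|S^2|}{N}(1-\epsilon)\le w_i\le\frac{|S^2|}{N}(1-\epsilon)^{-1}$ for all $i$ and $\sum_i w_ip(x_i)=\int_{S^2}p\,d\omega$ for all such $p$. It is *fundamental* (with order $t$) if the zero polynomial is the only spherical polynomial of degree $\le t$ that vanishes at all $x_i$. Fix real spherical harmonics $Y_{\ell,k}$ of degree $\ell$ ($0\le\ell\le t$, $1\le k\le 2\ell+1$), orthonormal in $L^2(S^2,\omega)$, and let $Y(X_N)$ be the $N\times N$ matrix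 with entry $Y_{\ell,k}(x_i)$ in row $i$ and column $\ell^2+k$. Let $\|A\|_1=\max_j\sum_i|A_{ij}|$ and $\tau=\sqrt{\frac{2t+1}{4\pi}}\,(t+1)^3$. Let $\mathbb{X}_N=\{[x]_1,\dots,[x]_N\}$ be a family of spherical caps $[x]_i=\{x\in S^2:\mathrm{dist}(x,\hat x_i)\le\gamma_i\}$ with centres $\hat x_i\in S^2$ and radii $\gamma_i\ge 0$. Put $\hat X_N=\{\hat x_1,\dots,\hat x_N\}$, $\mathrm{rad}(\mathbb{X}_N)=\max_i\gamma_i$ and $\rho(\mathbb{X}_N)=\min\{\mathrm{dist}(x,y): x\in[x]_i,\ y\in[x]_j,\ i\ne j\}$. Write $X_N\in\mathbb{X}_N$ if, for every $i$, $x_i\in[x]_i$ and $x_i\notin[x]_j$ for all $j\ne i$. **Theorem 3.2.** Assume that some spherical $t$-design $X_N^0$ satisfies $X_N^0\in\mathbb{X}_N$ and that $Y(\hat X_N)$ is nonsingular. Let $0\le\epsilon<1$ and suppose that $$\mathrm{rad}(\mathbb{X}_N)<\min\left(\frac14\rho(\mathbb{X}_N),\ \frac{\epsilon}{2(1+2\epsilon)\,\tau\,\|Y(\hat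 X_N)^{-1}\|_1}\right).$$ Then every point set $X_N\in\mathbb{X}_N$ is a fundamental spherical $t_\epsilon$-design. Moreover, every $X_N\in\mathbb{X}_N$ is a fundamental spherical $t_{\epsilon'}$-design for every $\epsilon'$ with $$\frac{2\tau\,\mathrm{rad}(\mathbb{X}_N)\,\|Y(\hat X_N)^{-1}\|_1}{1-4\tau\,\mathrm{rad}(\mathbb{X}_N)\,\|Y(\hat X_N)^{-1}\|_1}\le\epsilon'<1.$$ -/

import Mathlib

open MeasureTheory

noncomputable section

namespace SphericalDesigns

/-- The unit two-sphere in Euclidean three-space. -/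
abbrev S2 : Type := Metric.sphere (0 : EuclideanSpace ℝ (Fin 3)) 1

/-- The surface measure on the sphere (of total mass `4 * π`). -/
def surfaceMeasure : Measure S2 :=
  (volume : Measure (EuclideanSpace ℝ (Fin 3))).toSphere

/-- The area of the sphere. -/
def area : ℝ := surfaceMeasure.real Set.univ

/-- The value at a point of the sphere of a real polynomial in three variables. -/
def evalAt (p : MvPolynomial (Fin 3) ℝ) (x : S2) : ℝ :=
  MvPolynomial.eval (fun i => (x : EuclideanSpace ℝ (Fin 3)) i) p

/-- `f` is a spherical polynomial of degree at most `t`: the restriction to the sphere of a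
real polynomial in three variables of total degree at most `t`. -/
def IsSphericalPolynomial (t : ℕ) (f : S2 → ℝ) : Prop :=
  ∃ p : MvPolynomial (Fin 3) ℝ, p.totalDegree ≤ t ∧ ∀ x, f x = evalAt p x

/-- `f` is a real spherical harmonic of degree `ℓ`: the restriction to the sphere of a harmonic
homogeneous polynomial of degree `ℓ`. -/
def IsSphericalHarmonic (l : ℕ) (f : S2 → ℝ) : Prop :=
  ∃ p : MvPolynomial (Fin 3) ℝ, p.IsHomogeneous l ∧
    ∑ i, MvPolynomial.pderiv i (MvPolynomial.pderiv i p) = 0 ∧ ∀ x, f x = evalAt p x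

/-- The functions `Y l k`, for `0 ≤ l ≤ t` and `1 ≤ k ≤ 2 * l + 1`, are real spherical harmonics,
`Y l k` having degree `l`, and they are orthonormal for the surface measure.
The values of `Y` at other indices are irrelevant. -/
structure IsOrthonormalHarmonics (t : ℕ) (Y : ℕ → ℕ → S2 → ℝ) : Prop where
  harmonic : ∀ l ≤ t, ∀ k ∈ Finset.Icc 1 (2 * l + 1), IsSphericalHarmonic l (Y l k)
  orthonormal : ∀ l ≤ t, ∀ k ∈ Finset.Icc 1 (2 * l + 1),
    ∀ l' ≤ t, ∀ k' ∈ Finset.Icc 1 (2 * l' + 1),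
      ∫ x, Y l k x * Y l' k' x ∂surfaceMeasure = if l = l' ∧ k = k' then 1 else 0

/-- The square matrix of the values of the harmonics of degree at most `t` at `(t + 1) ^ 2` points.
With rows and columns counted from one, the entry in row `i` and column `l ^ 2 + k` is
`Y l k (X i)`, where `0 ≤ l ≤ t` and `1 ≤ k ≤ 2 * l + 1`. As `Fin` counts from zero, column `j`
belongs to `l = Nat.sqrt j` and `k = j - l ^ 2 + 1`. -/
def harmonicMatrix (t : ℕ) (Y : ℕ → ℕ → S2 → ℝ) (X : Fin ((t + 1) ^ 2) → S2) :
    Matrix (Fin ((t + 1) ^ 2)) (Fin ((t + 1) ^ 2)) ℝ :=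
  Matrix.of fun i j => Y (Nat.sqrt j) ((j : ℕ) - Nat.sqrt j ^ 2 + 1) (X i)

/-- The matrix norm induced by the `1`-norm of vectors: the maximal absolute column sum. -/
def norm1 {n : ℕ} (A : Matrix (Fin n) (Fin n) ℝ) : ℝ := ⨆ j, ∑ i, |A i j|

/-- A spherical `t`-design of `N` (distinct) points. -/
def IsSphericalDesign (t : ℕ) {N : ℕ} (X : Fin N → S2) : Prop :=
  Function.Injective X ∧ ∀ f : S2 → ℝ, IsSphericalPolynomial t f →
    1 / (N : ℝ) * ∑ i, f (X i) = 1 / area * ∫ x, f x ∂surfaceMeasure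

/-- A spherical `t_ε`-design of `N` (distinct) points. -/
def IsSphericalEpsDesign (t : ℕ) (ε : ℝ) {N : ℕ} (X : Fin N → S2) : Prop :=
  0 ≤ ε ∧ ε < 1 ∧ Function.Injective X ∧ ∃ w : Fin N → ℝ,
    (∀ i, area / N * (1 - ε) ≤ w i ∧ w i ≤ area / N * (1 - ε)⁻¹) ∧
    ∀ f : S2 → ℝ, IsSphericalPolynomial t f →
      ∑ i, w i * f (X i) = ∫ x, f x ∂surfaceMeasure

/-- The points are fundamental with order `t`: only the zero spherical polynomial of degree at
most `t` vanishes at all of them. -/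
def IsFundamental (t : ℕ) {N : ℕ} (X : Fin N → S2) : Prop :=
  ∀ f : S2 → ℝ, IsSphericalPolynomial t f → (∀ i, f (X i) = 0) → ∀ x, f x = 0

/-- The geodesic distance on the sphere. -/
def geodist (x y : S2) : ℝ :=
  Real.arccos (inner ℝ (x : EuclideanSpace ℝ (Fin 3)) (y : EuclideanSpace ℝ (Fin 3)))

/-- The closed spherical cap with center `c` and (geodesic) radius `r`. -/
def cap (c : S2) (r : ℝ) : Set S2 := {x | geodist x c ≤ r}

/-- A family of `N` spherical caps, given by their centers and radii. -/
structure CapFamily (N : ℕ) where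
  center : Fin N → S2
  radius : Fin N → ℝ
  radius_nonneg : ∀ i, 0 ≤ radius i

namespace CapFamily

variable {N : ℕ}

/-- The `i`-th cap of the family. -/
def caps (C : CapFamily N) (i : Fin N) : Set S2 := cap (C.center i) (C.radius i)

/-- The radius of the family: the maximal radius of its caps. -/
def rad (C : CapFamily N) : ℝ := ⨆ i, C.radius i

/-- The separation distance of the family: the minimal geodesic distance between a point of one
cap and a point of a cap with a different index. -/
def sep (C : CapFamily N) : ℝ :=
  sInf {d : ℝ | ∃ i j, i ≠ j ∧ ∃ x ∈ C.caps i, ∃ y ∈ C.caps j, d = geodist x y}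

/-- The family is an interval enclosure of the points `X`: each `X i` lies in the `i`-th cap and
in no other one. -/
def Encloses (C : CapFamily N) (X : Fin N → S2) : Prop :=
  ∀ i, X i ∈ C.caps i ∧ ∀ j, j ≠ i → X i ∉ C.caps j

end CapFamily

/-- The constant `τ = √((2 t + 1) / (4 π)) (t + 1) ^ 3`. -/
def tau (t : ℕ) : ℝ := Real.sqrt ((2 * (t : ℝ) + 1) / (4 * Real.pi)) * ((t : ℝ) + 1) ^ 3

end SphericalDesigns

end

namespace SphericalDesigns

open scoped Pointwise

/-! Write `A`, `B`, `B₀` for the matrices at the centres, at `X` and at the design, `e` for the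
integrals of the harmonics, `a = area / N`, `K = norm1 A⁻¹`. The design says `a B₀ = e` with `a` as
a constant row vector, and weights `w` are exact for `X` iff `w B = e`. Hence `(w - a) B = a (B₀ -
B)`, and everything reduces to perturbing `A`: if moving points by `rad` changes each column by at
most `d = τ rad` in the 1-norm, then `d K < 1` makes `B` invertible (`det_ne_zero_of_perturbation`),
so `X` is fundamental, and the relative error of `w` is at most `2 d K / (1 - d K)`
(`exists_weights`).

The analytic input is a Lipschitz constant for harmonics (`abs_sub_le_of_orthonormal_harmonics`).
Rotation invariance makes the sum of squares of an orthonormal basis of degree `l` constant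
(`sum_sq_eq_of_orthonormal`). Taking the Laplacian of this identity gives the sum of the squared
gradients (`sum_sq_gradient`); removing the radial part, known from Euler's identity, bounds the
tangential derivatives, which are integrated along great circles.

Orthonormal families span because upper bounds for the dimensions, `2 l + 1` and `(t + 1) ^ 2`,
match their sizes. -/

/-! ### Surface measure and its invariance under isometries -/

instance : IsFiniteMeasure surfaceMeasure := by
  unfold surfaceMeasure; infer_instance

lemma area_eq : area = 4 * Real.pi := by
  rw [area, surfaceMeasure, Measure.toSphere_real_apply_univ, Measure.real,
    EuclideanSpace.volume_ball_fin_three]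
  simp only [finrank_euclideanSpace, Fintype.card_fin, ENNReal.ofReal_one, one_pow, one_mul]
  rw [ENNReal.toReal_ofReal (by positivity)]
  push_cast
  ring

/-- The action of a linear isometry on the sphere. -/
noncomputable def rotate (R : EuclideanSpace ℝ (Fin 3) ≃ₗᵢ[ℝ] EuclideanSpace ℝ (Fin 3)) (x : S2) : S2 :=
  ⟨R x, by simp⟩

lemma continuous_rotate (R : EuclideanSpace ℝ (Fin 3) ≃ₗᵢ[ℝ] EuclideanSpace ℝ (Fin 3)) :
    Continuous (rotate R) :=
  (R.continuous.comp continuous_subtype_val).subtype_mk _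

/-- The measure of a set is a multiple of the volume of the cone over it; isometries commute with
forming cones and preserve volume. -/
lemma measurePreserving_rotate
    (R : EuclideanSpace ℝ (Fin 3) ≃ₗᵢ[ℝ] EuclideanSpace ℝ (Fin 3)) :
    MeasurePreserving (rotate R) surfaceMeasure surfaceMeasure := by
  refine ⟨(continuous_rotate R).measurable, ?_⟩
  ext s hs
  have hs' := (continuous_rotate R).measurable hs
  rw [Measure.map_apply (continuous_rotate R).measurable hs, surfaceMeasure,
    Measure.toSphere_apply' _ hs, Measure.toSphere_apply' _ hs']
  congr 1
  have key : (Set.Ioo (0 : ℝ) 1 • ((↑) '' (rotate R ⁻¹' s) : Set (EuclideanSpace ℝ (Fin 3)))) =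
      R ⁻¹' (Set.Ioo (0 : ℝ) 1 • ((↑) '' s : Set (EuclideanSpace ℝ (Fin 3)))) := by
    ext v
    simp only [Set.mem_smul, Set.mem_image, Set.mem_preimage]
    constructor
    · rintro ⟨r, hr, _, ⟨x, hx, rfl⟩, rfl⟩
      exact ⟨r, hr, R x, ⟨rotate R x, hx, rfl⟩, by simp⟩
    · rintro ⟨r, hr, _, ⟨x, hx, rfl⟩, h⟩
      refine ⟨r, hr, R.symm x, ⟨rotate R.symm x, ?_, rfl⟩, ?_⟩
      · have : rotate R (rotate R.symm x) = x := Subtype.ext (R.apply_symm_apply _)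
        rwa [this]
      · rw [← map_smul, h, R.symm_apply_apply]
  rw [key]
  exact (R.measurePreserving).measure_preimage_equiv (f := R.toMeasurableEquiv) _

lemma exists_rotate_eq (x y : S2) : ∃ R, rotate R x = y :=
  ⟨(ℝ ∙ ((x : EuclideanSpace ℝ (Fin 3)) - y))ᗮ.reflection,
    Subtype.ext (Submodule.reflection_sub (by simp))⟩

lemma integral_rotate (R : EuclideanSpace ℝ (Fin 3) ≃ₗᵢ[ℝ] EuclideanSpace ℝ (Fin 3))
    {f : S2 → ℝ} (hf : Continuous f) :
    ∫ x, f (rotate R x) ∂surfaceMeasure = ∫ x, f x ∂surfaceMeasure := by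
  have h := measurePreserving_rotate R
  conv_rhs => rw [← h.map_eq]
  rw [integral_map h.measurable.aemeasurable hf.aestronglyMeasurable]

lemma integrable_of_continuous {f : S2 → ℝ} (hf : Continuous f) :
    Integrable f surfaceMeasure :=
  hf.integrable_of_hasCompactSupport (HasCompactSupport.of_compactSpace f)

/-! ### Orthonormal families of functions and constancy of their sum of squares -/

section Orthonormal

variable {ι : Type*} [Fintype ι] [DecidableEq ι] {φ : ι → S2 → ℝ}

lemma integral_sum_mul_of_orthonormal (hc : ∀ i, Continuous (φ i))
    (ho : ∀ i j, ∫ x, φ i x * φ j x ∂surfaceMeasure = if i = j then 1 else 0)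
    (c : ι → ℝ) (j : ι) :
    ∫ x, (∑ i, c i * φ i x) * φ j x ∂surfaceMeasure = c j := by
  simp_rw [Finset.sum_mul, mul_assoc]
  rw [integral_finsetSum]
  · simp_rw [integral_const_mul, ho]
    simp
  · exact fun i _ => integrable_of_continuous (by fun_prop)

lemma linearIndependent_of_orthonormal (hc : ∀ i, Continuous (φ i))
    (ho : ∀ i j, ∫ x, φ i x * φ j x ∂surfaceMeasure = if i = j then 1 else 0) :
    LinearIndependent ℝ φ := by
  rw [Fintype.linearIndependent_iff]
  intro c h j
  rw [← integral_sum_mul_of_orthonormal hc ho c j]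
  have : ∀ x, ∑ i, c i * φ i x = 0 := fun x => by simpa using congrFun h x
  simp [this]

lemma exists_eq_sum_of_orthonormal (hc : ∀ i, Continuous (φ i))
    (ho : ∀ i j, ∫ x, φ i x * φ j x ∂surfaceMeasure = if i = j then 1 else 0)
    {V : Submodule ℝ (S2 → ℝ)} [FiniteDimensional ℝ V]
    (hV : Module.finrank ℝ V ≤ Fintype.card ι)
    (hφ : ∀ i, φ i ∈ V) {f : S2 → ℝ} (hf : f ∈ V) :
    ∃ c : ι → ℝ, ∀ x, f x = ∑ i, c i * φ i x := by
  have hli := linearIndependent_of_orthonormal hc ho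
  have hle : Submodule.span ℝ (Set.range φ) ≤ V := by
    rw [Submodule.span_le]; rintro _ ⟨i, rfl⟩; exact hφ i
  have heq := Submodule.eq_of_le_of_finrank_le hle (by rwa [finrank_span_eq_card hli])
  rw [← heq, Submodule.mem_span_range_iff_exists_fun] at hf
  obtain ⟨c, rfl⟩ := hf
  exact ⟨c, fun x => by simp⟩

/-- If the span of an orthonormal family is invariant under isometries of the sphere, then the
sum of squares of the family is constant. -/
lemma sum_sq_eq_of_orthonormal (hc : ∀ i, Continuous (φ i))
    (ho : ∀ i j, ∫ x, φ i x * φ j x ∂surfaceMeasure = if i = j then 1 else 0)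
    (hrot : ∀ R i, ∃ c : ι → ℝ, ∀ x, φ i (rotate R x) = ∑ j, c j * φ j x) (x : S2) :
    ∑ i, φ i x ^ 2 = Fintype.card ι / area := by
  have hinv : ∀ R x, ∑ i, φ i (rotate R x) ^ 2 = ∑ i, φ i x ^ 2 := by
    intro R x
    choose B hB using hrot R
    -- The rotated family is again orthonormal, so its coefficient matrix is orthogonal.
    have hBB : Matrix.of B * (Matrix.of B).transpose = 1 := by
      ext i k
      rw [Matrix.one_apply, ← ho i k,
        ← integral_rotate R (f := fun x => φ i x * φ k x) ((hc i).mul (hc k))]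
      simp_rw [hB k, Finset.mul_sum, mul_left_comm _ (B k _)]
      rw [integral_finsetSum]
      · simp_rw [integral_const_mul, hB i, integral_sum_mul_of_orthonormal hc ho]
        simp [Matrix.mul_apply, mul_comm]
      · intro j _
        exact integrable_of_continuous (continuous_const.mul
          (((hc i).comp (continuous_rotate R)).mul (hc j)))
    have hBB' := mul_eq_one_comm.mp hBB
    have h1 : (fun i => φ i (rotate R x)) = (Matrix.of B).mulVec (fun i => φ i x) := by
      ext i; simp [hB, Matrix.mulVec, dotProduct]
    have h2 : ∀ v : ι → ℝ, ∑ i, v i ^ 2 = v ⬝ᵥ v := fun v => by simp [dotProduct, sq]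
    rw [h2 fun i => φ i (rotate R x), h2 fun i => φ i x, h1, Matrix.dotProduct_mulVec,
      ← Matrix.mulVec_transpose, Matrix.mulVec_mulVec, hBB', Matrix.one_mulVec]
  have hconst : ∀ y, ∑ i, φ i y ^ 2 = ∑ i, φ i x ^ 2 := fun y => by
    obtain ⟨R, rfl⟩ := exists_rotate_eq x y
    exact hinv R x
  -- Integrating identifies the constant.
  have hint : ∫ y, ∑ i, φ i y ^ 2 ∂surfaceMeasure = Fintype.card ι := by
    rw [integral_finsetSum]
    · simp_rw [sq, ho]
      simp
    · exact fun i _ => integrable_of_continuous (by fun_prop)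
  simp_rw [hconst] at hint
  rw [integral_const, smul_eq_mul, ← area] at hint
  have : area ≠ 0 := by rw [area_eq]; positivity
  field_simp
  linarith

end Orthonormal

open MvPolynomial

/-! ### Chain rules and homogeneity for polynomials -/

section Calculus

variable {σ τ : Type*} [Fintype σ]

lemma pderiv_bind₁ (g : σ → MvPolynomial τ ℝ) (i : τ) (p : MvPolynomial σ ℝ) :
    pderiv i (bind₁ g p) = ∑ j, bind₁ g (pderiv j p) * pderiv i (g j) := by
  classical
  induction p using MvPolynomial.induction_on with
  | C a => simp
  | add p q hp hq => simp only [map_add, hp, hq, add_mul, Finset.sum_add_distrib]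
  | mul_X p j hp =>
    simp only [map_mul, pderiv_mul, hp, bind₁_X_right, map_add, add_mul, Finset.sum_add_distrib,
      pderiv_X, Pi.single_apply, mul_ite, mul_one, mul_zero]
    congr 1
    · rw [Finset.sum_mul]
      exact Finset.sum_congr rfl fun k _ => by ring
    · rw [Finset.sum_eq_single j]
      · simp
      · intro k _ hk
        simp [Ne.symm hk]
      · simp

lemma hasDerivAt_eval (p : MvPolynomial σ ℝ) {γ : ℝ → σ → ℝ} {γ' : σ → ℝ} {s : ℝ}
    (hγ : ∀ i, HasDerivAt (fun s => γ s i) (γ' i) s) :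
    HasDerivAt (fun s => eval (γ s) p) (∑ i, γ' i * eval (γ s) (pderiv i p)) s := by
  classical
  induction p using MvPolynomial.induction_on with
  | C a => simpa using hasDerivAt_const s a
  | add p q hp hq =>
    simpa only [map_add, mul_add, Finset.sum_add_distrib] using hp.fun_add hq
  | mul_X p j hp =>
    have h := hp.fun_mul (hγ j)
    simp only [map_mul, eval_X]
    refine h.congr_deriv ?_
    simp only [pderiv_mul, pderiv_X, Pi.single_apply, mul_ite, mul_one, mul_zero, map_add,
      map_mul, eval_X, mul_add, Finset.sum_add_distrib, Finset.sum_mul]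
    congr 1
    · exact Finset.sum_congr rfl fun k _ => by ring
    · rw [Finset.sum_eq_single j]
      · simp [mul_comm]
      · intro k _ hk
        simp [Ne.symm hk]
      · simp

lemma eval_smul_of_isHomogeneous {p : MvPolynomial σ ℝ} {n : ℕ} (hp : p.IsHomogeneous n)
    (r : ℝ) (v : σ → ℝ) : eval (r • v) p = r ^ n * eval v p := by
  rw [eval_eq', eval_eq', Finset.mul_sum]
  refine Finset.sum_congr rfl fun d hd => ?_
  have : ∑ i, d i = n := by
    rw [← hp (mem_support_iff.mp hd), ← Finsupp.degree_eq_sum, Finsupp.degree_eq_weight_one]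
    rfl
  simp only [Pi.smul_apply, smul_eq_mul, mul_pow, Finset.prod_mul_distrib]
  rw [Finset.prod_pow_eq_pow_sum, this]
  ring

end Calculus

lemma continuous_evalAt (p : MvPolynomial (Fin 3) ℝ) : Continuous (evalAt p) := by
  exact (MvPolynomial.continuous_eval p).comp (by fun_prop)

lemma sum_sq_coord (x : S2) : ∑ i, (x : EuclideanSpace ℝ (Fin 3)) i ^ 2 = 1 := by
  have h : ‖(x : EuclideanSpace ℝ (Fin 3))‖ = 1 := by simp
  have := EuclideanSpace.real_norm_sq_eq (x : EuclideanSpace ℝ (Fin 3))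
  rw [← this, h, one_pow]

lemma exists_eq_smul_coord (v : Fin 3 → ℝ) :
    ∃ (r : ℝ) (x : S2), v = r • fun i => (x : EuclideanSpace ℝ (Fin 3)) i := by
  by_cases hv : v = 0
  · exact ⟨0, ⟨EuclideanSpace.single 0 1, by simp⟩, by simp [hv]⟩
  · have hv' : WithLp.toLp 2 v ≠ 0 := by simpa using hv
    refine ⟨‖WithLp.toLp 2 v‖, ⟨‖WithLp.toLp 2 v‖⁻¹ • WithLp.toLp 2 v, ?_⟩, ?_⟩
    · simp [norm_smul, hv]
    · ext i
      simp [hv]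

/-- Homogeneous polynomials are determined by their values on the sphere. -/
lemma eq_of_evalAt_eq {p q : MvPolynomial (Fin 3) ℝ} {n : ℕ} (hp : p.IsHomogeneous n)
    (hq : q.IsHomogeneous n) (h : ∀ x, evalAt p x = evalAt q x) : p = q := by
  refine MvPolynomial.funext fun v => ?_
  obtain ⟨r, x, rfl⟩ := exists_eq_smul_coord v
  rw [eval_smul_of_isHomogeneous hp, eval_smul_of_isHomogeneous hq]
  congr 1
  exact h x

/-! ### Harmonic polynomials and the bound for their dimension -/

section Laplacian

/-- The Laplacian of polynomials in three variables. -/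
noncomputable def laplacian : MvPolynomial (Fin 3) ℝ →ₗ[ℝ] MvPolynomial (Fin 3) ℝ :=
  ∑ i, (pderiv i).toLinearMap ∘ₗ (pderiv i).toLinearMap

lemma laplacian_apply (p : MvPolynomial (Fin 3) ℝ) :
    laplacian p = ∑ i, pderiv i (pderiv i p) := by
  simp [laplacian]

lemma laplacian_mul_self {p : MvPolynomial (Fin 3) ℝ} (hp : laplacian p = 0) :
    laplacian (p * p) = 2 * ∑ i, pderiv i p ^ 2 := by
  have : laplacian (p * p) = 2 * ∑ i, pderiv i p ^ 2 + 2 * p * laplacian p := by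
    simp only [laplacian_apply, pderiv_mul, map_add, Finset.mul_sum, ← Finset.sum_add_distrib]
    exact Finset.sum_congr rfl fun i _ => by ring
  rw [this, hp]; ring

lemma evalAt_laplacian_normSq_pow (l : ℕ) (x : S2) :
    evalAt (laplacian ((∑ i, X i ^ 2) ^ l)) x = 2 * l * (2 * l + 1) := by
  have hx := sum_sq_coord x
  set S : MvPolynomial (Fin 3) ℝ := ∑ i, X i ^ 2 with hS
  have hS' : ∀ i, pderiv i S = 2 * X i := by
    intro i
    rw [hS, map_sum, Finset.sum_eq_single i]
    · simp
    · intro j _ hj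
      simp [pderiv_X_of_ne hj]
    · simp
  have hSe : eval (fun i => (x : EuclideanSpace ℝ (Fin 3)) i) S = 1 := by
    simpa [hS] using hx
  have h2 : ∀ i, pderiv i (2 : MvPolynomial (Fin 3) ℝ) = 0 := fun i => by
    rw [← map_ofNat C, pderiv_C]
  rw [evalAt, laplacian_apply, map_sum]
  rcases l with _ | l
  · simp
  · have hterm : ∀ i, eval (fun i => (x : EuclideanSpace ℝ (Fin 3)) i)
        (pderiv i (pderiv i (S ^ (l + 1)))) =
        4 * (l + 1) * l * (x : EuclideanSpace ℝ (Fin 3)) i ^ 2 + 2 * (l + 1) := by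
      intro i
      have hl : ∀ n : ℕ, pderiv i (n : MvPolynomial (Fin 3) ℝ) = 0 := fun n => by
        rw [← map_natCast C, pderiv_C]
      simp only [pderiv_pow, pderiv_mul, hS', map_add, map_mul, map_pow, hSe, h2, hl, pderiv_X_self,
        one_pow, map_natCast, map_ofNat, eval_X, map_zero, Nat.add_sub_cancel]
      push_cast
      simp
      ring
    simp_rw [hterm, Finset.sum_add_distrib, ← Finset.mul_sum, hx]
    simp
    ring

/-- Harmonic homogeneous polynomials of degree `l` in three variables. -/
noncomputable def harmonicPolys (l : ℕ) : Submodule ℝ (MvPolynomial (Fin 3) ℝ) :=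
  homogeneousSubmodule (Fin 3) ℝ l ⊓ LinearMap.ker laplacian

lemma mem_harmonicPolys {l : ℕ} {p : MvPolynomial (Fin 3) ℝ} :
    p ∈ harmonicPolys l ↔ p.IsHomogeneous l ∧ laplacian p = 0 := Iff.rfl

/-- The exponent of a monomial in three variables. -/
noncomputable def exponent (a b c : ℕ) : Fin 3 →₀ ℕ := Finsupp.equivFunOnFinite.symm ![a, b, c]

lemma eq_exponent (m : Fin 3 →₀ ℕ) : m = exponent (m 0) (m 1) (m 2) := by
  ext i; fin_cases i <;> simp [exponent]

/-- The coefficients of a homogeneous polynomial of degree `l` at the monomials that contain the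
last variable at most once. -/
noncomputable def lowCoeffs (l : ℕ) : MvPolynomial (Fin 3) ℝ →ₗ[ℝ] (Fin (l + 1) ⊕ Fin l → ℝ) :=
  LinearMap.pi fun a => lcoeff ℝ <|
    Sum.elim (fun a : Fin (l + 1) => exponent a (l - a) 0)
      (fun a : Fin l => exponent a (l - 1 - a) 1) a

/-- Harmonicity is a recursion that expresses a coefficient with exponent `n + 2` in the last
variable through coefficients with exponent `n`, so the exponents 0 and 1 determine everything. -/
lemma eq_zero_of_lowCoeffs_eq_zero {l : ℕ} {p : MvPolynomial (Fin 3) ℝ}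
    (hp : p ∈ harmonicPolys l) (h : lowCoeffs l p = 0) : p = 0 := by
  obtain ⟨hhom, hlap⟩ := mem_harmonicPolys.mp hp
  have key : ∀ (n : ℕ) (m : Fin 3 →₀ ℕ), m 2 = n → coeff m p = 0 := by
    intro n
    induction n using Nat.strong_induction_on with
    | _ n ih =>
      intro m hm
      by_cases hdeg : m.degree = l
      swap
      · exact hhom.coeff_eq_zero hdeg
      have hsum : m 0 + m 1 + m 2 = l := by
        rw [← hdeg, Finsupp.degree_eq_sum, Fin.sum_univ_three]
      rcases n with _ | _ | n
      · have h0 := congrFun h (Sum.inl ⟨m 0, by omega⟩)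
        have : l - m 0 = m 1 := by omega
        simp only [lowCoeffs, LinearMap.pi_apply, lcoeff_apply, Sum.elim_inl, this,
          Pi.zero_apply] at h0
        rwa [eq_exponent m, hm]
      · have h0 := congrFun h (Sum.inr ⟨m 0, by omega⟩)
        have : l - 1 - m 0 = m 1 := by omega
        simp only [lowCoeffs, LinearMap.pi_apply, lcoeff_apply, Sum.elim_inr, this,
          Pi.zero_apply] at h0
        rwa [eq_exponent m, hm]
      -- At `m'`, the second derivative in the last variable contributes a nonzero multiple of the
      -- coefficient at `m`; the other two contributions vanish by induction.
      · set m' := m - Finsupp.single 2 2 with hm'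
        have hmm : m' + Finsupp.single 2 1 + Finsupp.single 2 1 = m := by
          rw [add_assoc, ← Finsupp.single_add]
          refine tsub_add_cancel_of_le ?_
          rw [Finsupp.single_le_iff]; omega
        have hm2 : m' 2 = n := by simp [hm', hm]
        have hc := congrArg (coeff m') hlap
        simp only [laplacian_apply, Fin.sum_univ_three, coeff_add, coeff_pderiv, coeff_zero,
          hmm] at hc
        rw [ih n (by omega) (m' + Finsupp.single 0 1 + Finsupp.single 0 1) (by simp [hm2]),
          ih n (by omega) (m' + Finsupp.single 1 1 + Finsupp.single 1 1) (by simp [hm2])] at hc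
        simp only [zero_mul, zero_add, mul_eq_zero] at hc
        rcases hc with (hc | hc) | hc
        · exact hc
        · exact absurd hc (by positivity)
        · exact absurd hc (by positivity)
  ext m
  rw [key _ m rfl, coeff_zero]

lemma injective_lowCoeffs (l : ℕ) :
    Function.Injective ((lowCoeffs l).domRestrict (harmonicPolys l)) := by
  rw [injective_iff_map_eq_zero]
  intro p hp
  exact Subtype.ext (eq_zero_of_lowCoeffs_eq_zero p.2 hp)

instance (l : ℕ) : FiniteDimensional ℝ (harmonicPolys l) :=
  Module.Finite.of_injective _ (injective_lowCoeffs l)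

lemma finrank_harmonicPolys_le (l : ℕ) : Module.finrank ℝ (harmonicPolys l) ≤ 2 * l + 1 := by
  refine (LinearMap.finrank_le_finrank_of_injective (injective_lowCoeffs l)).trans ?_
  simp; omega

end Laplacian

/-- Restriction of polynomials to the sphere. -/
noncomputable def restrictToSphere : MvPolynomial (Fin 3) ℝ →ₗ[ℝ] (S2 → ℝ) where
  toFun := evalAt
  map_add' p q := by ext x; simp [evalAt]
  map_smul' c p := by ext x; simp [evalAt]

/-- The space of spherical harmonics of degree `l`. -/
noncomputable def harmonics (l : ℕ) : Submodule ℝ (S2 → ℝ) :=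
  (harmonicPolys l).map restrictToSphere

lemma mem_harmonics {l : ℕ} {f : S2 → ℝ} : f ∈ harmonics l ↔ IsSphericalHarmonic l f := by
  constructor
  · rintro ⟨p, hp, rfl⟩
    exact ⟨p, hp.1, by rw [← laplacian_apply]; exact hp.2, fun _ => rfl⟩
  · rintro ⟨p, hp, hl, h⟩
    exact ⟨p, ⟨hp, by rwa [← laplacian_apply] at hl⟩, (funext h).symm⟩

instance (l : ℕ) : FiniteDimensional ℝ (harmonics l) := by
  unfold harmonics; infer_instance

lemma finrank_harmonics_le (l : ℕ) : Module.finrank ℝ (harmonics l) ≤ 2 * l + 1 :=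
  (Submodule.finrank_map_le _ _).trans (finrank_harmonicPolys_le l)

/-! ### Isometries preserve spherical harmonics -/

section Rotation

variable (R : EuclideanSpace ℝ (Fin 3) ≃ₗᵢ[ℝ] EuclideanSpace ℝ (Fin 3))

/-- The entries of the matrix of a linear isometry. -/
noncomputable def isometryEntry (j i : Fin 3) : ℝ := R (EuclideanSpace.single i 1) j

lemma apply_eq_sum_isometryEntry (v : EuclideanSpace ℝ (Fin 3)) (j : Fin 3) :
    R v j = ∑ i, isometryEntry R j i * v i := by
  have hv : v = ∑ i, v i • EuclideanSpace.single i (1 : ℝ) := by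
    ext k; simp [Finset.sum_apply, Pi.single_apply]
  conv_lhs => rw [hv]
  simp [isometryEntry, mul_comm]

/-- Preservation of inner products makes the columns orthonormal; for a square matrix the rows are
then orthonormal too. -/
lemma sum_isometryEntry_mul (j k : Fin 3) :
    ∑ i, isometryEntry R j i * isometryEntry R k i = if j = k then 1 else 0 := by
  have h : (Matrix.of (isometryEntry R)).transpose * Matrix.of (isometryEntry R) = 1 := by
    ext i k
    have := R.inner_map_map (EuclideanSpace.single k 1) (EuclideanSpace.single i (1 : ℝ))
    rw [PiLp.inner_apply, EuclideanSpace.inner_single_left] at this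
    simpa [Matrix.mul_apply, isometryEntry, Matrix.one_apply, Pi.single_apply, eq_comm] using this
  have := congrArg (fun M : Matrix (Fin 3) (Fin 3) ℝ => M j k) (mul_eq_one_comm.mp h)
  simpa [Matrix.mul_apply, Matrix.one_apply] using this

/-- The linear forms given by the coordinates of a linear isometry. -/
noncomputable def isometryForm (j : Fin 3) : MvPolynomial (Fin 3) ℝ :=
  ∑ i, C (isometryEntry R j i) * X i

lemma pderiv_isometryForm (i j : Fin 3) :
    pderiv i (isometryForm R j) = C (isometryEntry R j i) := by
  simp [isometryForm, pderiv_X, Pi.single_apply]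

/-- By the chain rule mixed second derivatives appear with the inner products of rows as factors, so
only the diagonal ones survive. -/
lemma laplacian_bind₁_isometryForm (p : MvPolynomial (Fin 3) ℝ) :
    laplacian (bind₁ (isometryForm R) p) = bind₁ (isometryForm R) (laplacian p) := by
  have h1 : ∀ i, pderiv i (pderiv i (bind₁ (isometryForm R) p)) =
      ∑ j, ∑ k, bind₁ (isometryForm R) (pderiv k (pderiv j p)) *
        C (isometryEntry R j i * isometryEntry R k i) := by
    intro i
    simp only [pderiv_bind₁, pderiv_isometryForm, map_sum, pderiv_mul, pderiv_C, mul_zero,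
      add_zero, Finset.sum_mul, C_mul]
    exact Finset.sum_congr rfl fun j _ => Finset.sum_congr rfl fun k _ => by ring
  simp only [laplacian_apply, h1]
  rw [Finset.sum_comm, map_sum]
  refine Finset.sum_congr rfl fun j _ => ?_
  rw [Finset.sum_comm]
  simp_rw [← Finset.mul_sum, ← map_sum, sum_isometryEntry_mul]
  rw [Finset.sum_eq_single j] <;> simp +contextual [eq_comm]

lemma evalAt_bind₁_isometryForm (p : MvPolynomial (Fin 3) ℝ) (x : S2) :
    evalAt (bind₁ (isometryForm R) p) x = evalAt p (rotate R x) := by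
  rw [evalAt, ← aeval_eq_eval, aeval_bind₁, evalAt, ← aeval_eq_eval]
  congr 2
  ext j
  simp [isometryForm, rotate, apply_eq_sum_isometryEntry]

lemma harmonics_rotate {l : ℕ} {f : S2 → ℝ} (hf : f ∈ harmonics l) :
    (fun x => f (rotate R x)) ∈ harmonics l := by
  obtain ⟨p, hp, rfl⟩ := hf
  obtain ⟨hhom, hlap⟩ := mem_harmonicPolys.mp hp
  refine ⟨bind₁ (isometryForm R) p, mem_harmonicPolys.mpr ⟨?_, ?_⟩, ?_⟩
  · have := hhom.aeval (isometryForm R) (n := 1) fun j =>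
      IsHomogeneous.sum _ _ _ fun i _ => isHomogeneous_C_mul_X _ _
    rwa [one_mul] at this
  · rw [laplacian_bind₁_isometryForm, hlap, map_zero]
  · ext x
    exact evalAt_bind₁_isometryForm R p x

end Rotation

/-! ### Gradients of spherical harmonics -/

section Gradient

variable {ι : Type*} [Fintype ι]

/-- By homogeneity the sum of squares is `c |x| ^ (2 l)` on all of space. Apply the Laplacian: as
each `p k` is harmonic, the left side becomes twice the sum of squared gradients. -/
lemma sum_sq_gradient {l : ℕ} {p : ι → MvPolynomial (Fin 3) ℝ}
    (hp : ∀ k, p k ∈ harmonicPolys l) {c : ℝ} (hc : ∀ x, ∑ k, evalAt (p k) x ^ 2 = c) (x : S2) :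
    ∑ k, ∑ i, evalAt (pderiv i (p k)) x ^ 2 = c * l * (2 * l + 1) := by
  have hQ : ∑ k, p k * p k = c • (∑ i, X i ^ 2) ^ l := by
    refine eq_of_evalAt_eq (n := 2 * l) ?_ ?_ fun y => ?_
    · refine IsHomogeneous.sum _ _ _ fun k _ => ?_
      rw [two_mul]
      exact (hp k).1.mul (hp k).1
    · rw [smul_eq_C_mul]
      exact ((IsHomogeneous.sum _ _ 2 fun i _ => isHomogeneous_X_pow i 2).pow l).C_mul c
    · have h := sum_sq_coord y
      have hcy := hc y
      simp only [evalAt, sq] at hcy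
      simp [evalAt, h, hcy]
  have h := congrArg (fun q => evalAt (laplacian q) x) hQ
  simp only [map_sum, map_smul, fun k => laplacian_mul_self (hp k).2] at h
  have h2 := evalAt_laplacian_normSq_pow l x
  simp only [evalAt] at h h2 ⊢
  rw [smul_eval, h2] at h
  simp only [map_sum, map_mul, map_pow, map_ofNat, ← Finset.mul_sum] at h
  linarith

/-- Bessel's inequality for the orthonormal pair `x`, `u`. -/
lemma sq_tangential_add_sq_radial_le (G x u : Fin 3 → ℝ) (hx : ∑ i, x i ^ 2 = 1)
    (hu : ∑ i, u i ^ 2 = 1) (hxu : ∑ i, x i * u i = 0) :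
    (∑ i, u i * G i) ^ 2 + (∑ i, x i * G i) ^ 2 ≤ ∑ i, G i ^ 2 := by
  set a := ∑ i, u i * G i with ha
  set b := ∑ i, x i * G i with hb
  have h : 0 ≤ ∑ i, (G i - a * u i - b * x i) ^ 2 := Finset.sum_nonneg fun i _ => sq_nonneg _
  have h' : ∑ i, (G i - a * u i - b * x i) ^ 2 = ∑ i, G i ^ 2 + a ^ 2 * ∑ i, u i ^ 2 +
      b ^ 2 * ∑ i, x i ^ 2 - 2 * a * ∑ i, u i * G i - 2 * b * ∑ i, x i * G i +
      2 * a * b * ∑ i, x i * u i := by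
    simp only [Finset.mul_sum, ← Finset.sum_add_distrib, ← Finset.sum_sub_distrib]
    exact Finset.sum_congr rfl fun i _ => by ring
  rw [h', hx, hu, hxu, ← ha, ← hb] at h
  linarith

/-- The derivatives in tangential directions of spherical harmonics whose squares add up to a
constant. -/
lemma sq_tangential_deriv_le {l : ℕ} {p : ι → MvPolynomial (Fin 3) ℝ}
    (hp : ∀ k, p k ∈ harmonicPolys l) {c : ℝ} (hc : ∀ x, ∑ k, evalAt (p k) x ^ 2 = c) (x : S2)
    (u : Fin 3 → ℝ) (hu : ∑ i, u i ^ 2 = 1)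
    (hxu : ∑ i, (x : EuclideanSpace ℝ (Fin 3)) i * u i = 0) (k : ι) :
    (∑ i, u i * evalAt (pderiv i (p k)) x) ^ 2 ≤ c * (l * (l + 1)) := by
  have hk : ∀ k, (∑ i, u i * evalAt (pderiv i (p k)) x) ^ 2 ≤
      ∑ i, evalAt (pderiv i (p k)) x ^ 2 - l ^ 2 * evalAt (p k) x ^ 2 := by
    intro k
    have h := sq_tangential_add_sq_radial_le (fun i => evalAt (pderiv i (p k)) x)
      (fun i => (x : EuclideanSpace ℝ (Fin 3)) i) u (sum_sq_coord x) hu hxu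
    -- Euler's identity: the radial derivative is `l` times the value.
    have he := congrArg (fun q => evalAt q x) (IsHomogeneous.sum_X_mul_pderiv (hp k).1)
    simp only [evalAt, map_sum, map_mul, eval_X, nsmul_eq_mul, map_natCast] at he h ⊢
    rw [he] at h
    linarith [mul_pow (l : ℝ) (eval (fun i => (x : EuclideanSpace ℝ (Fin 3)) i) (p k)) 2]
  calc _ ≤ ∑ k, (∑ i, u i * evalAt (pderiv i (p k)) x) ^ 2 :=
        Finset.single_le_sum (f := fun k => (∑ i, u i * evalAt (pderiv i (p k)) x) ^ 2)
          (fun k _ => sq_nonneg _) (Finset.mem_univ k)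
    _ ≤ ∑ k, (∑ i, evalAt (pderiv i (p k)) x ^ 2 - l ^ 2 * evalAt (p k) x ^ 2) :=
        Finset.sum_le_sum fun k _ => hk k
    _ = c * (l * (l + 1)) := by
        rw [Finset.sum_sub_distrib, sum_sq_gradient hp hc, ← Finset.mul_sum, hc]
        ring

end Gradient

/-! ### Great circles and Lipschitz bounds -/

section GreatCircle

lemma exists_orthogonal_unit (x : EuclideanSpace ℝ (Fin 3)) :
    ∃ u : EuclideanSpace ℝ (Fin 3), ‖u‖ = 1 ∧ inner ℝ x u = 0 := by
  have h : (ℝ ∙ x)ᗮ ≠ ⊥ := by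
    intro h
    have h1 := Submodule.finrank_add_finrank_orthogonal (ℝ ∙ x)
    have h2 : Module.finrank ℝ (ℝ ∙ x) ≤ 1 := by
      simpa using finrank_span_le_card (R := ℝ) {x}
    rw [h, finrank_bot, finrank_euclideanSpace, Fintype.card_fin] at h1
    omega
  obtain ⟨v, hv, hv0⟩ := Submodule.exists_mem_ne_zero_of_ne_bot h
  rw [Submodule.mem_orthogonal_singleton_iff_inner_right] at hv
  exact ⟨‖v‖⁻¹ • v, by simp [norm_smul, hv0], by rw [inner_smul_right, hv, mul_zero]⟩

lemma geodist_nonneg (x y : S2) : 0 ≤ geodist x y := Real.arccos_nonneg _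

lemma geodist_comm (x y : S2) : geodist x y = geodist y x := by
  rw [geodist, geodist, real_inner_comm]

/-- Any two points of the sphere are joined by an arc of a great circle. -/
lemma exists_great_circle (x y : S2) : ∃ u : EuclideanSpace ℝ (Fin 3), ‖u‖ = 1 ∧
    inner ℝ (x : EuclideanSpace ℝ (Fin 3)) u = 0 ∧
    (y : EuclideanSpace ℝ (Fin 3)) =
      Real.cos (geodist x y) • (x : EuclideanSpace ℝ (Fin 3)) + Real.sin (geodist x y) • u := by
  set c : ℝ := inner ℝ (x : EuclideanSpace ℝ (Fin 3)) (y : EuclideanSpace ℝ (Fin 3)) with hc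
  have hx : ‖(x : EuclideanSpace ℝ (Fin 3))‖ = 1 := by simp
  have hy : ‖(y : EuclideanSpace ℝ (Fin 3))‖ = 1 := by simp
  have habs : |c| ≤ 1 := by
    simpa [hx, hy] using
      abs_real_inner_le_norm (x : EuclideanSpace ℝ (Fin 3)) (y : EuclideanSpace ℝ (Fin 3))
  have hcos : Real.cos (geodist x y) = c :=
    Real.cos_arccos (abs_le.mp habs).1 (abs_le.mp habs).2
  have hnorm : ‖(y : EuclideanSpace ℝ (Fin 3)) - c • (x : EuclideanSpace ℝ (Fin 3))‖ =
      Real.sin (geodist x y) := by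
    have hsin : 0 ≤ Real.sin (geodist x y) :=
      Real.sin_nonneg_of_nonneg_of_le_pi (Real.arccos_nonneg _) (Real.arccos_le_pi _)
    rw [← sq_eq_sq₀ (norm_nonneg _) hsin, Real.sin_sq, hcos, norm_sub_sq_real, norm_smul,
      inner_smul_right, hx, hy, real_inner_comm, ← hc, mul_one, Real.norm_eq_abs, sq_abs]
    ring
  rw [hcos]
  -- A vanishing sine means that `y` is `x` or its antipode; any orthogonal direction then serves.
  by_cases h0 : Real.sin (geodist x y) = 0
  · obtain ⟨u, hu, hxu⟩ := exists_orthogonal_unit x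
    refine ⟨u, hu, hxu, ?_⟩
    rw [h0, norm_eq_zero, sub_eq_zero] at hnorm
    rw [h0, zero_smul, add_zero, hnorm]
  · refine ⟨(Real.sin (geodist x y))⁻¹ •
      ((y : EuclideanSpace ℝ (Fin 3)) - c • (x : EuclideanSpace ℝ (Fin 3))), ?_, ?_, ?_⟩
    · rw [norm_smul, hnorm, norm_inv, ← hnorm, norm_norm]
      exact inv_mul_cancel₀ (by rwa [hnorm])
    · rw [inner_smul_right, inner_sub_right, inner_smul_right, real_inner_self_eq_norm_sq, hx,
        ← hc]
      ring
    · rw [smul_inv_smul₀ h0]; abel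

/-- A bound on all tangential derivatives of a polynomial is a Lipschitz constant for the geodesic
distance. -/
lemma abs_evalAt_sub_le {p : MvPolynomial (Fin 3) ℝ} {M : ℝ}
    (hM : ∀ (x : S2) (u : Fin 3 → ℝ), ∑ i, u i ^ 2 = 1 →
      ∑ i, (x : EuclideanSpace ℝ (Fin 3)) i * u i = 0 →
      |∑ i, u i * evalAt (pderiv i p) x| ≤ M) (x y : S2) :
    |evalAt p y - evalAt p x| ≤ M * geodist x y := by
  obtain ⟨u, hu, hxu, hy⟩ := exists_great_circle x y
  have hu' : ∑ i, u i ^ 2 = 1 := by rw [← EuclideanSpace.real_norm_sq_eq, hu, one_pow]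
  have hx' := sum_sq_coord x
  have hxu' : ∑ i, (x : EuclideanSpace ℝ (Fin 3)) i * u i = 0 := by
    rw [PiLp.inner_apply] at hxu
    simpa [mul_comm] using hxu
  set γ : ℝ → Fin 3 → ℝ := fun s i =>
    Real.cos s * (x : EuclideanSpace ℝ (Fin 3)) i + Real.sin s * u i with hγ
  set γ' : ℝ → Fin 3 → ℝ := fun s i =>
    -Real.sin s * (x : EuclideanSpace ℝ (Fin 3)) i + Real.cos s * u i with hγ'
  have hderiv : ∀ s, HasDerivAt (fun s => eval (γ s) p)
      (∑ i, γ' s i * eval (γ s) (pderiv i p)) s := fun s =>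
    hasDerivAt_eval p fun i =>
      ((Real.hasDerivAt_cos s).mul_const _).add ((Real.hasDerivAt_sin s).mul_const _)
  -- Used three times: `γ` stays on the sphere, has unit speed, and has velocity orthogonal to
  -- position.
  have quad : ∀ a b a' b' : ℝ, ∑ i, (a * (x : EuclideanSpace ℝ (Fin 3)) i + b * u i) *
      (a' * (x : EuclideanSpace ℝ (Fin 3)) i + b' * u i) = a * a' + b * b' := by
    intro a b a' b'
    have : ∑ i, (a * (x : EuclideanSpace ℝ (Fin 3)) i + b * u i) *
        (a' * (x : EuclideanSpace ℝ (Fin 3)) i + b' * u i) =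
        a * a' * ∑ i, (x : EuclideanSpace ℝ (Fin 3)) i ^ 2 + b * b' * ∑ i, u i ^ 2 +
        (a * b' + b * a') * ∑ i, (x : EuclideanSpace ℝ (Fin 3)) i * u i := by
      simp only [Finset.mul_sum, ← Finset.sum_add_distrib]
      exact Finset.sum_congr rfl fun i _ => by ring
    rw [this, hx', hu', hxu']; ring
  have hbound : ∀ s, ‖∑ i, γ' s i * eval (γ s) (pderiv i p)‖ ≤ M := by
    intro s
    have hs : WithLp.toLp 2 (γ s) ∈ Metric.sphere (0 : EuclideanSpace ℝ (Fin 3)) 1 := by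
      rw [mem_sphere_zero_iff_norm, EuclideanSpace.norm_eq, Real.sqrt_eq_one]
      have := quad (Real.cos s) (Real.sin s) (Real.cos s) (Real.sin s)
      simp only [hγ, Real.norm_eq_abs, sq_abs]
      simp only [← sq] at this
      rw [this, Real.cos_sq_add_sin_sq]
    refine hM ⟨_, hs⟩ (γ' s) ?_ ?_
    · have := quad (-Real.sin s) (Real.cos s) (-Real.sin s) (Real.cos s)
      simp only [← sq, neg_sq] at this
      rw [hγ', this, Real.sin_sq_add_cos_sq]
    · have := quad (Real.cos s) (Real.sin s) (-Real.sin s) (Real.cos s)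
      simp only [hγ, hγ', this]
      ring
  have h := (convex_univ (𝕜 := ℝ)).norm_image_sub_le_of_norm_hasDerivWithin_le
    (fun s _ => (hderiv s).hasDerivWithinAt) (fun s _ => hbound s)
    (Set.mem_univ (0 : ℝ)) (Set.mem_univ (geodist x y))
  have h0 : γ 0 = fun i => (x : EuclideanSpace ℝ (Fin 3)) i := by ext i; simp [hγ]
  have h1 : γ (geodist x y) = fun i => (y : EuclideanSpace ℝ (Fin 3)) i := by
    ext i
    conv_rhs => rw [hy]
    simp [hγ]
  rw [h0, h1, sub_zero, Real.norm_of_nonneg (geodist_nonneg x y)] at h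
  exact h

end GreatCircle

/-! ### Dimension bound for spherical polynomials -/

section Polynomials

/-- The spherical polynomials of degree at most `t`. -/
noncomputable def sphericalPolys (t : ℕ) : Submodule ℝ (S2 → ℝ) :=
  (restrictTotalDegree (Fin 3) ℝ t).map restrictToSphere

lemma mem_sphericalPolys {t : ℕ} {f : S2 → ℝ} :
    f ∈ sphericalPolys t ↔ IsSphericalPolynomial t f := by
  constructor
  · rintro ⟨p, hp, rfl⟩
    exact ⟨p, (mem_restrictTotalDegree _ _ _).mp hp, fun _ => rfl⟩
  · rintro ⟨p, hp, h⟩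
    exact ⟨p, (mem_restrictTotalDegree _ _ _).mpr hp, (funext h).symm⟩

/-- A monomial as a function on the sphere. -/
noncomputable def sphereMonomial (a b c : ℕ) (x : S2) : ℝ :=
  (x : EuclideanSpace ℝ (Fin 3)) 0 ^ a * (x : EuclideanSpace ℝ (Fin 3)) 1 ^ b *
    (x : EuclideanSpace ℝ (Fin 3)) 2 ^ c

/-- The monomials of degree at most `t` that contain the last variable at most once, indexed by a
square: those without it by the lower triangle, the others by the upper one. -/
noncomputable def reducedMonomial (t : ℕ) (ij : Fin (t + 1) × Fin (t + 1)) : S2 → ℝ :=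
  if (ij.1 : ℕ) + ij.2 ≤ t then sphereMonomial ij.1 ij.2 0
  else sphereMonomial (t - ij.1) (t - ij.2) 1

/-- On the sphere the square of the last coordinate is one minus the other two squares; substituting
it lowers the last exponent by two without raising the total degree. -/
lemma sphereMonomial_mem_span (t : ℕ) (a b c : ℕ) (h : a + b + c ≤ t) :
    sphereMonomial a b c ∈ Submodule.span ℝ (Set.range (reducedMonomial t)) := by
  induction c using Nat.strong_induction_on generalizing a b with
  | _ c ih =>
    rcases c with _ | _ | c
    · refine Submodule.subset_span ⟨(⟨a, by omega⟩, ⟨b, by omega⟩), ?_⟩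
      rw [reducedMonomial, if_pos (by simpa using h)]
    -- Here `a + b + 1 ≤ t`, so the reflected indices add up to more than `t` and lie in the upper
    -- triangle.
    · refine Submodule.subset_span ⟨(⟨t - a, by omega⟩, ⟨t - b, by omega⟩), ?_⟩
      rw [reducedMonomial, if_neg (by simp only; omega)]
      simp only
      congr 1 <;> omega
    · have heq : sphereMonomial a b (c + 1 + 1) = sphereMonomial a b c -
          sphereMonomial (a + 2) b c - sphereMonomial a (b + 2) c := by
        ext x
        have hx := sum_sq_coord x
        rw [Fin.sum_univ_three] at hx
        have h2 : (x : EuclideanSpace ℝ (Fin 3)) 2 ^ 2 = 1 -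
          (x : EuclideanSpace ℝ (Fin 3)) 0 ^ 2 - (x : EuclideanSpace ℝ (Fin 3)) 1 ^ 2 := by
          linarith
        simp only [sphereMonomial, Pi.sub_apply, pow_add _ c 1, pow_add _ (c + 1) 1,
          pow_add _ a 2, pow_add _ b 2]
        linear_combination (x : EuclideanSpace ℝ (Fin 3)) 0 ^ a *
          (x : EuclideanSpace ℝ (Fin 3)) 1 ^ b * (x : EuclideanSpace ℝ (Fin 3)) 2 ^ c * h2
      rw [heq]
      exact Submodule.sub_mem _ (Submodule.sub_mem _ (ih c (by omega) _ _ (by omega))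
        (ih c (by omega) _ _ (by omega))) (ih c (by omega) _ _ (by omega))

lemma sphericalPolys_le_span (t : ℕ) :
    sphericalPolys t ≤ Submodule.span ℝ (Set.range (reducedMonomial t)) := by
  rintro _ ⟨p, hp, rfl⟩
  have hp' : p.totalDegree ≤ t := (mem_restrictTotalDegree _ _ _).mp hp
  have heq : restrictToSphere p =
      ∑ d ∈ p.support, coeff d p • sphereMonomial (d 0) (d 1) (d 2) := by
    ext x
    simp [restrictToSphere, evalAt, eval_eq', Fin.prod_univ_three, sphereMonomial]
  rw [heq]
  refine Submodule.sum_mem _ fun d hd => Submodule.smul_mem _ _ (sphereMonomial_mem_span _ _ _ _ ?_)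
  have := le_totalDegree hd
  rw [Finsupp.sum_fintype _ _ fun _ => rfl, Fin.sum_univ_three] at this
  omega

instance (t : ℕ) : FiniteDimensional ℝ (sphericalPolys t) :=
  have : FiniteDimensional ℝ (Submodule.span ℝ (Set.range (reducedMonomial t))) :=
    FiniteDimensional.span_of_finite ℝ (Set.finite_range _)
  Submodule.finiteDimensional_of_le (sphericalPolys_le_span t)

lemma finrank_sphericalPolys_le (t : ℕ) : Module.finrank ℝ (sphericalPolys t) ≤ (t + 1) ^ 2 := by
  have : FiniteDimensional ℝ (Submodule.span ℝ (Set.range (reducedMonomial t))) :=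
    FiniteDimensional.span_of_finite ℝ (Set.finite_range _)
  refine (Submodule.finrank_mono (sphericalPolys_le_span t)).trans ?_
  refine (finrank_range_le_card (reducedMonomial t)).trans ?_
  simp [sq]

end Polynomials

/-! ### Lipschitz constant of orthonormal harmonics -/

section Harmonics

lemma continuous_of_isSphericalHarmonic {l : ℕ} {f : S2 → ℝ} (hf : IsSphericalHarmonic l f) :
    Continuous f := by
  obtain ⟨p, _, _, h⟩ := hf
  rw [funext h]
  exact continuous_evalAt p

/-- The members of an orthonormal basis of the spherical harmonics of degree `l` are Lipschitz. -/
lemma abs_sub_le_of_orthonormal_harmonics {l : ℕ} {ψ : Fin (2 * l + 1) → S2 → ℝ}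
    (hψ : ∀ k, IsSphericalHarmonic l (ψ k))
    (ho : ∀ i j, ∫ x, ψ i x * ψ j x ∂surfaceMeasure = if i = j then 1 else 0)
    (k : Fin (2 * l + 1)) (x y : S2) :
    |ψ k x - ψ k y| ≤ Real.sqrt ((2 * l + 1) / (4 * Real.pi)) * (l + 1) * geodist x y := by
  have hc := fun k => continuous_of_isSphericalHarmonic (hψ k)
  have hmem := fun k => mem_harmonics.mpr (hψ k)
  have hsum := sum_sq_eq_of_orthonormal hc ho fun R i =>
    exists_eq_sum_of_orthonormal hc ho (by simpa using finrank_harmonics_le l) hmem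
      (harmonics_rotate R (hmem i))
  choose p hp hpe using hmem
  obtain rfl : (fun k => evalAt (p k)) = ψ := funext hpe
  rw [geodist_comm]
  refine abs_evalAt_sub_le (fun z u hu hzu => ?_) y x
  have h := sq_tangential_deriv_le hp hsum z u hu hzu k
  -- The factor `l (l + 1)` is relaxed to `(l + 1) ^ 2`.
  refine abs_le_of_sq_le_sq (h.trans ?_) (by positivity)
  rw [mul_pow, Real.sq_sqrt (by positivity), area_eq, Fintype.card_fin]
  push_cast
  gcongr
  nlinarith

end Harmonics

end SphericalDesigns

namespace SphericalDesigns

/-! ### The matrix of harmonics and its dependence on the points -/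

section Columns

variable {t : ℕ} {Y : ℕ → ℕ → S2 → ℝ}

/-- The harmonic in the column `j` of the matrix `harmonicMatrix`. -/
def column (Y : ℕ → ℕ → S2 → ℝ) (j : ℕ) : S2 → ℝ := Y (Nat.sqrt j) (j - Nat.sqrt j ^ 2 + 1)

lemma sqrt_le_of_lt {j : ℕ} (hj : j < (t + 1) ^ 2) : Nat.sqrt j ≤ t :=
  Nat.lt_succ_iff.mp (Nat.sqrt_lt'.mpr hj)

lemma column_index_mem (j : ℕ) :
    j - Nat.sqrt j ^ 2 + 1 ∈ Finset.Icc 1 (2 * Nat.sqrt j + 1) := by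
  have h1 := Nat.sqrt_le_add j
  rw [Finset.mem_Icc, sq]
  omega

lemma isSphericalHarmonic_column (hY : IsOrthonormalHarmonics t Y) (j : Fin ((t + 1) ^ 2)) :
    IsSphericalHarmonic (Nat.sqrt j) (column Y j) :=
  hY.harmonic _ (sqrt_le_of_lt j.2) _ (column_index_mem j)

lemma continuous_column (hY : IsOrthonormalHarmonics t Y) (j : Fin ((t + 1) ^ 2)) :
    Continuous (column Y j) :=
  continuous_of_isSphericalHarmonic (isSphericalHarmonic_column hY j)

lemma integral_column_mul_column (hY : IsOrthonormalHarmonics t Y) (i j : Fin ((t + 1) ^ 2)) :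
    ∫ x, column Y i x * column Y j x ∂surfaceMeasure = if i = j then 1 else 0 := by
  unfold column
  rw [hY.orthonormal _ (sqrt_le_of_lt i.2) _ (column_index_mem i) _ (sqrt_le_of_lt j.2) _
    (column_index_mem j)]
  congr 1
  -- The truncated differences are exact, so `l` and `k` recover the column index.
  have hi := Nat.sqrt_le' (i : ℕ)
  have hj := Nat.sqrt_le' (j : ℕ)
  refine propext ⟨fun ⟨h1, h2⟩ => Fin.ext ?_, fun h => by simp [h]⟩
  rw [h1] at h2 hi
  omega

lemma isSphericalPolynomial_column (hY : IsOrthonormalHarmonics t Y) (j : Fin ((t + 1) ^ 2)) :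
    IsSphericalPolynomial t (column Y j) := by
  obtain ⟨p, hp, _, h⟩ := isSphericalHarmonic_column hY j
  exact ⟨p, hp.totalDegree_le.trans (sqrt_le_of_lt j.2), h⟩

lemma exists_eq_sum_column (hY : IsOrthonormalHarmonics t Y) {f : S2 → ℝ}
    (hf : IsSphericalPolynomial t f) :
    ∃ c : Fin ((t + 1) ^ 2) → ℝ, ∀ x, f x = ∑ j, c j * column Y j x :=
  exists_eq_sum_of_orthonormal (continuous_column hY) (integral_column_mul_column hY)
    (by simpa using finrank_sphericalPolys_le t)
    (fun j => mem_sphericalPolys.mpr (isSphericalPolynomial_column hY j))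
    (mem_sphericalPolys.mpr hf)

lemma abs_harmonic_sub_le (hY : IsOrthonormalHarmonics t Y) {l k : ℕ} (hl : l ≤ t)
    (hk : k ∈ Finset.Icc 1 (2 * l + 1)) (x y : S2) :
    |Y l k x - Y l k y| ≤
      Real.sqrt ((2 * t + 1) / (4 * Real.pi)) * (t + 1) * geodist x y := by
  obtain ⟨hk1, hk2⟩ := Finset.mem_Icc.mp hk
  have hm : ∀ k : Fin (2 * l + 1), (k : ℕ) + 1 ∈ Finset.Icc 1 (2 * l + 1) := fun k =>
    Finset.mem_Icc.mpr ⟨by omega, by omega⟩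
  have h := abs_sub_le_of_orthonormal_harmonics (l := l) (ψ := fun k => Y l (k + 1))
    (fun k => hY.harmonic l hl _ (hm k)) (fun i j => by
      rw [hY.orthonormal l hl _ (hm i) l hl _ (hm j)]
      simp [Fin.ext_iff]) ⟨k - 1, by omega⟩ x y
  simp only [Nat.sub_add_cancel hk1] at h
  refine h.trans ?_
  have := geodist_nonneg x y
  gcongr

lemma abs_column_sub_le (hY : IsOrthonormalHarmonics t Y) (j : Fin ((t + 1) ^ 2)) (x y : S2) :
    |column Y j x - column Y j y| ≤
      Real.sqrt ((2 * t + 1) / (4 * Real.pi)) * (t + 1) * geodist x y :=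
  abs_harmonic_sub_le hY (sqrt_le_of_lt j.2) (column_index_mem j) x y

/-- Moving the points by at most `r` moves every column of the matrix of harmonics by at most
`τ r` in the `1`-norm. -/
lemma sum_abs_harmonicMatrix_sub_le (hY : IsOrthonormalHarmonics t Y)
    {X Z : Fin ((t + 1) ^ 2) → S2} {r : ℝ} (h : ∀ i, geodist (X i) (Z i) ≤ r)
    (j : Fin ((t + 1) ^ 2)) :
    ∑ i, |(harmonicMatrix t Y X - harmonicMatrix t Y Z) i j| ≤ tau t * r := by
  have hj : ∀ i, |(harmonicMatrix t Y X - harmonicMatrix t Y Z) i j| ≤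
      Real.sqrt ((2 * t + 1) / (4 * Real.pi)) * (t + 1) * r := fun i =>
    (abs_column_sub_le hY j (X i) (Z i)).trans (by gcongr; exact h i)
  -- The `(t + 1) ^ 2` rows turn the factor `t + 1` into the cube in `tau`.
  refine (Finset.sum_le_sum fun i _ => hj i).trans (le_of_eq ?_)
  simp only [Finset.sum_const, Finset.card_univ, Fintype.card_fin, nsmul_eq_mul, tau]
  push_cast
  ring

lemma isFundamental_of_det_ne_zero (hY : IsOrthonormalHarmonics t Y)
    {X : Fin ((t + 1) ^ 2) → S2} (h : (harmonicMatrix t Y X).det ≠ 0) : IsFundamental t X := by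
  intro f hf hX x
  obtain ⟨c, hc⟩ := exists_eq_sum_column hY hf
  have h0 : (harmonicMatrix t Y X).mulVec c = 0 := by
    ext i
    rw [Pi.zero_apply, ← hX i, hc]
    simp only [Matrix.mulVec, dotProduct, mul_comm (c _)]
    rfl
  have hc0 := Matrix.eq_zero_of_mulVec_eq_zero h h0
  simp [hc, hc0]

/-- A quadrature rule is exact for all spherical polynomials if it is exact for the harmonics. -/
lemma sum_mul_eq_integral (hY : IsOrthonormalHarmonics t Y)
    {X : Fin ((t + 1) ^ 2) → S2} {w : Fin ((t + 1) ^ 2) → ℝ}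
    (hw : Matrix.vecMul w (harmonicMatrix t Y X) =
      fun j : Fin ((t + 1) ^ 2) => ∫ x, column Y j x ∂surfaceMeasure)
    {f : S2 → ℝ} (hf : IsSphericalPolynomial t f) :
    ∑ i, w i * f (X i) = ∫ x, f x ∂surfaceMeasure := by
  obtain ⟨c, hc⟩ := exists_eq_sum_column hY hf
  simp_rw [hc]
  rw [integral_finsetSum]
  · simp_rw [integral_const_mul]
    have hw' : ∀ j : Fin ((t + 1) ^ 2), ∫ x, column Y (j : ℕ) x ∂surfaceMeasure =
        ∑ i, w i * column Y j (X i) := fun j => (congrFun hw j).symm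
    simp_rw [hw', Finset.mul_sum]
    rw [Finset.sum_comm]
    exact Finset.sum_congr rfl fun j _ => Finset.sum_congr rfl fun i _ => by ring
  · exact fun j _ => integrable_of_continuous (continuous_const.mul (continuous_column hY j))

end Columns

/-! ### Perturbation of nonsingular matrices -/

section MatrixNorm

variable {n : ℕ}

/-- Column sums control the action on row vectors in the sup norm; this is the side on which
quadrature weights live. -/
lemma norm_vecMul_le {M : Matrix (Fin n) (Fin n) ℝ} {c : ℝ} (hc0 : 0 ≤ c)
    (hc : ∀ j, ∑ i, |M i j| ≤ c) (v : Fin n → ℝ) : ‖Matrix.vecMul v M‖ ≤ c * ‖v‖ := by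
  refine (pi_norm_le_iff_of_nonneg (by positivity)).mpr fun j => ?_
  calc ‖∑ i, v i * M i j‖ ≤ ∑ i, ‖v i * M i j‖ := norm_sum_le _ _
    _ ≤ ∑ i, ‖v‖ * |M i j| := Finset.sum_le_sum fun i _ => by
        rw [norm_mul, Real.norm_eq_abs (M i j)]
        gcongr
        exact norm_le_pi_norm v i
    _ ≤ c * ‖v‖ := by
        rw [← Finset.mul_sum, mul_comm]
        gcongr
        exact hc j

lemma sum_abs_le_norm1 (M : Matrix (Fin n) (Fin n) ℝ) (j : Fin n) :
    ∑ i, |M i j| ≤ norm1 M :=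
  le_ciSup (f := fun j => ∑ i, |M i j|) (Set.finite_range _).bddAbove j

lemma norm1_nonneg (M : Matrix (Fin n) (Fin n) ℝ) : 0 ≤ norm1 M :=
  Real.iSup_nonneg fun _ => Finset.sum_nonneg fun _ _ => abs_nonneg _

/-- If `B` is a perturbation of the nonsingular matrix `A`, then `v` is controlled by `v B`. -/
lemma norm_le_of_perturbation {A B : Matrix (Fin n) (Fin n) ℝ} (hA : A.det ≠ 0) {d : ℝ}
    (hd0 : 0 ≤ d) (hd : ∀ j, ∑ i, |(A - B) i j| ≤ d) (v : Fin n → ℝ) :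
    ‖v‖ * (1 - d * norm1 A⁻¹) ≤ norm1 A⁻¹ * ‖Matrix.vecMul v B‖ := by
  -- The sum in parentheses is `v A`.
  have hv : v = Matrix.vecMul (Matrix.vecMul v B + Matrix.vecMul v (A - B)) A⁻¹ := by
    rw [← Matrix.vecMul_add, add_sub_cancel, Matrix.vecMul_vecMul,
      Matrix.mul_nonsing_inv _ (Ne.isUnit hA), Matrix.vecMul_one]
  have h1 : ‖v‖ ≤ norm1 A⁻¹ * (‖Matrix.vecMul v B‖ + d * ‖v‖) := by
    conv_lhs => rw [hv]
    refine (norm_vecMul_le (norm1_nonneg _) (sum_abs_le_norm1 _) _).trans ?_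
    gcongr
    · exact norm1_nonneg _
    · exact (norm_add_le _ _).trans (by gcongr; exact norm_vecMul_le hd0 hd v)
  linarith

lemma det_ne_zero_of_perturbation {A B : Matrix (Fin n) (Fin n) ℝ} (hA : A.det ≠ 0) {d : ℝ}
    (hd0 : 0 ≤ d) (hd : ∀ j, ∑ i, |(A - B) i j| ≤ d) (h1 : d * norm1 A⁻¹ < 1) :
    B.det ≠ 0 := by
  intro h
  obtain ⟨v, hv0, hv⟩ := Matrix.exists_vecMul_eq_zero_iff.mpr h
  have := norm_le_of_perturbation hA hd0 hd v
  rw [hv, norm_zero, mul_zero] at this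
  have hpos : 0 < ‖v‖ := norm_pos_iff.mpr hv0
  have := mul_pos hpos (sub_pos.mpr h1)
  linarith

end MatrixNorm

/-! ### Enclosures, quadrature weights and the theorem -/

namespace CapFamily

variable {N : ℕ} {C : CapFamily N}

lemma radius_le_rad (i : Fin N) : C.radius i ≤ C.rad :=
  le_ciSup (Set.finite_range _).bddAbove i

lemma rad_nonneg : 0 ≤ C.rad := Real.iSup_nonneg C.radius_nonneg

lemma Encloses.injective {X : Fin N → S2} (hX : C.Encloses X) : Function.Injective X := by
  intro i j hij
  by_contra hne
  exact (hX i).2 j (Ne.symm hne) (hij ▸ (hX j).1)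

lemma Encloses.geodist_center_le {X : Fin N → S2} (hX : C.Encloses X) (i : Fin N) :
    geodist (X i) (C.center i) ≤ C.rad :=
  (hX i).1.trans (radius_le_rad i)

end CapFamily

lemma tau_pos (t : ℕ) : 0 < tau t := by
  unfold tau
  positivity

/-- The relative error of the weights for the points of an enclosure of a spherical design. -/
lemma exists_weights {t : ℕ} {Y : ℕ → ℕ → S2 → ℝ} (hY : IsOrthonormalHarmonics t Y)
    {C : CapFamily ((t + 1) ^ 2)} {X₀ X : Fin ((t + 1) ^ 2) → S2}
    (hX₀ : C.Encloses X₀) (hdesign : IsSphericalDesign t X₀) (hX : C.Encloses X)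
    (hdet : (harmonicMatrix t Y C.center).det ≠ 0)
    (h1 : tau t * C.rad * norm1 (harmonicMatrix t Y C.center)⁻¹ < 1) :
    (harmonicMatrix t Y X).det ≠ 0 ∧ ∃ w : Fin ((t + 1) ^ 2) → ℝ,
      (∀ f, IsSphericalPolynomial t f → ∑ i, w i * f (X i) = ∫ x, f x ∂surfaceMeasure) ∧
      ∀ i, |w i - area / ((t + 1) ^ 2 : ℕ)| *
          (1 - tau t * C.rad * norm1 (harmonicMatrix t Y C.center)⁻¹) ≤
        2 * tau t * C.rad * norm1 (harmonicMatrix t Y C.center)⁻¹ *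
          (area / ((t + 1) ^ 2 : ℕ)) := by
  set A := harmonicMatrix t Y C.center
  set B := harmonicMatrix t Y X
  set B₀ := harmonicMatrix t Y X₀
  set a : ℝ := area / ((t + 1) ^ 2 : ℕ) with ha
  have harea : 0 < area := by rw [area_eq]; positivity
  have ha0 : 0 < a := by positivity
  have hd0 : 0 ≤ tau t * C.rad := mul_nonneg (tau_pos t).le CapFamily.rad_nonneg
  have hAB : ∀ j, ∑ i, |(A - B) i j| ≤ tau t * C.rad := fun j =>
    sum_abs_harmonicMatrix_sub_le hY
      (fun i => by rw [geodist_comm]; exact hX.geodist_center_le i) j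
  have hBA : ∀ j, ∑ i, |(B₀ - A) i j| ≤ tau t * C.rad := fun j =>
    sum_abs_harmonicMatrix_sub_le hY hX₀.geodist_center_le j
  -- Comparison through the centres; this is the origin of the factor 2 in the error.
  have hBB : ∀ j, ∑ i, |(B₀ - B) i j| ≤ tau t * C.rad + tau t * C.rad := fun j => by
    refine le_trans ?_ (add_le_add (hBA j) (hAB j))
    rw [← Finset.sum_add_distrib]
    refine Finset.sum_le_sum fun i _ => ?_
    rw [← sub_add_sub_cancel B₀ A B, Matrix.add_apply]
    exact abs_add_le _ _
  have hB : B.det ≠ 0 := det_ne_zero_of_perturbation hdet hd0 hAB h1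
  have hdes : Matrix.vecMul (fun _ => a) B₀ =
      fun j : Fin ((t + 1) ^ 2) => ∫ x, column Y j x ∂surfaceMeasure := by
    ext j
    have h := hdesign.2 _ (isSphericalPolynomial_column hY j)
    have hsum : Matrix.vecMul (fun _ => a) B₀ j = a * ∑ i, column Y j (X₀ i) := by
      rw [Finset.mul_sum]; rfl
    rw [hsum, ha, div_mul_eq_mul_div, mul_div_assoc, ← one_div_mul_eq_div, h]
    field_simp
  set e : Fin ((t + 1) ^ 2) → ℝ := fun j : Fin ((t + 1) ^ 2) => ∫ x, column Y j x ∂surfaceMeasure with he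
  set w := Matrix.vecMul e B⁻¹ with hw
  have hwB : Matrix.vecMul w B = e := by
    rw [hw, Matrix.vecMul_vecMul, Matrix.nonsing_inv_mul _ (Ne.isUnit hB), Matrix.vecMul_one]
  refine ⟨hB, w, fun f hf => sum_mul_eq_integral hY hwB hf, fun i => ?_⟩
  -- Both `w B` and `a B₀` equal `e`.
  have hdiff : Matrix.vecMul (w - fun _ => a) B = Matrix.vecMul (fun _ => a) (B₀ - B) := by
    rw [Matrix.sub_vecMul, Matrix.vecMul_sub, hwB, hdes]
  have h2 := norm_le_of_perturbation hdet hd0 hAB (w - fun _ => a)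
  rw [hdiff] at h2
  have h3 := norm_vecMul_le (add_nonneg hd0 hd0) hBB (fun _ => a)
  have h4 : ‖fun _ : Fin ((t + 1) ^ 2) => a‖ ≤ a :=
    (pi_norm_le_iff_of_nonneg ha0.le).mpr fun _ => by rw [Real.norm_of_nonneg ha0.le]
  have h5 : |w i - a| ≤ ‖w - fun _ => a‖ := norm_le_pi_norm (w - fun _ => a) i
  have hK := norm1_nonneg A⁻¹
  calc |w i - a| * (1 - tau t * C.rad * norm1 A⁻¹)
      ≤ ‖w - fun _ => a‖ * (1 - tau t * C.rad * norm1 A⁻¹) := by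
        gcongr
    _ ≤ norm1 A⁻¹ * ((tau t * C.rad + tau t * C.rad) * a) :=
        h2.trans (by gcongr; exact h3.trans (by gcongr))
    _ = _ := by ring

end SphericalDesigns

open SphericalDesigns in
theorem theorem3p2 (t : ℕ) (ht : 1 ≤ t)
    (Y : ℕ → ℕ → S2 → ℝ) (hY : IsOrthonormalHarmonics t Y)
    (C : CapFamily ((t + 1) ^ 2))
    (hdesign : ∃ X₀ : Fin ((t + 1) ^ 2) → S2, C.Encloses X₀ ∧ IsSphericalDesign t X₀)
    (hdet : (harmonicMatrix t Y C.center).det ≠ 0)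
    (ε : ℝ) (hε0 : 0 ≤ ε) (hε1 : ε < 1)
    (hrad : C.rad < min (1 / 4 * C.sep)
      (ε / (2 * (1 + 2 * ε) * tau t * norm1 (harmonicMatrix t Y C.center)⁻¹)))
    (X : Fin ((t + 1) ^ 2) → S2) (hX : C.Encloses X) :
    IsFundamental t X ∧ IsSphericalEpsDesign t ε X ∧
      ∀ ε' : ℝ,
        2 * tau t * C.rad * norm1 (harmonicMatrix t Y C.center)⁻¹ /
            (1 - 4 * tau t * C.rad * norm1 (harmonicMatrix t Y C.center)⁻¹) ≤ ε' →
        ε' < 1 → IsSphericalEpsDesign t ε' X := by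
  obtain ⟨X₀, hX₀, hd⟩ := hdesign
  have hr2 := (lt_min_iff.mp hrad).2
  have hr0 := CapFamily.rad_nonneg (C := C)
  have hτ := tau_pos t
  have hK0 := norm1_nonneg (harmonicMatrix t Y C.center)⁻¹
  have hexists := exists_weights hY hX₀ hd hX hdet
  set K := norm1 (harmonicMatrix t Y C.center)⁻¹
  -- For `K = 0` the bound would be a division by zero, hence 0, forcing a negative radius.
  have hK : 0 < K := by
    refine hK0.lt_of_ne fun h => ?_
    rw [← h, mul_zero, div_zero] at hr2
    linarith
  have hden : 0 < 2 * (1 + 2 * ε) * tau t * K := by positivity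
  rw [lt_div_iff₀ hden] at hr2
  set q := tau t * C.rad * K with hq
  have hq0 : 0 ≤ q := by positivity
  have hqε : 2 * q * (1 + 2 * ε) < ε := by
    calc 2 * q * (1 + 2 * ε) = C.rad * (2 * (1 + 2 * ε) * tau t * K) := by rw [hq]; ring
      _ < ε := hr2
  have hq4 : 4 * q < 1 := by nlinarith
  obtain ⟨hB, w, hw, hwa⟩ := hexists (by linarith)
  have e2 : 2 * tau t * C.rad * K = 2 * q := by rw [hq]; ring
  have e4 : 4 * tau t * C.rad * K = 4 * q := by rw [hq]; ring
  rw [e2] at hwa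
  rw [e2, e4]
  have main : ∀ ε' : ℝ, 2 * q / (1 - 4 * q) ≤ ε' → ε' < 1 → IsSphericalEpsDesign t ε' X := by
    intro ε' h h1
    have h0 : 0 ≤ ε' := le_trans (div_nonneg (by linarith) (by linarith)) h
    refine ⟨h0, h1, hX.injective, w, fun i => ?_, hw⟩
    rw [div_le_iff₀ (by linarith)] at h
    have ha0 : 0 < area / ((t + 1) ^ 2 : ℕ) := by rw [area_eq]; positivity
    set a : ℝ := area / ((t + 1) ^ 2 : ℕ)
    have hwi : |w i - a| ≤ ε' * a := by
      refine le_of_mul_le_mul_right ((hwa i).trans ?_) (by linarith : 0 < 1 - q)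
      -- The weights allow the denominator `1 - q`; the assumption on `ε'` with `1 - 4 q` is
      -- stronger.
      calc 2 * q * a ≤ ε' * (1 - q) * a := by
            refine mul_le_mul_of_nonneg_right (h.trans ?_) ha0.le
            gcongr
            linarith
        _ = ε' * a * (1 - q) := by ring
    obtain ⟨hl, hu⟩ := abs_le.mp hwi
    refine ⟨by linarith, ?_⟩
    have hinv : 1 + ε' ≤ (1 - ε')⁻¹ := by
      rw [← one_div, le_div_iff₀ (by linarith)]
      nlinarith
    calc w i ≤ a * (1 + ε') := by linarith
      _ ≤ a * (1 - ε')⁻¹ := by gcongr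
  refine ⟨isFundamental_of_det_ne_zero hY hB, main ε ?_ hε1, main⟩
  -- The choice `ε' = ε` is admissible: `2 q ≤ ε (1 - 4 q)` rearranges `2 q (1 + 2 ε) ≤ ε`.
  rw [div_le_iff₀ (by linarith)]
  nlinarith
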